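/- Let $(R,\mathfrak m)$ be a one-dimensional (Noetherian) Cohen--Macaulay local ring with canonical module $\omega_R$, let $Q(R)$ be its total ring of fractions and $\overline R$ the integral closure of $R$ in $Q(R)$. Suppose that there is an $R$-submodule $C$ of $Q(R)$ with $R\subseteq C\subseteq\overline R$ and $C\cong\omega_R$, that $\overline R$ is finitely generated as an $R$-module, and that $\overline R$ is a local ring. Suppose that $R$ is far-flung Gorenstein, that is, the trace ideal $\mathrm{tr}_R(\omega_R)=\sum_{f\in\mathrm{Hom}_R(\omega_R,R)}\mathrm{Im} f$ is equal to the conductor $R:\overline R=\{\alpha\in Q(R)\mid \alpha\overline R\subseteq R\}$. Let $M$ be a finitely generated reflexive $R$-module (the canonical map $M\to\mathrm{Hom}_R(\mathrm{Hom}_R(M,R),R)$ is bijective) of rank $r>0$ (i.e. $Q(R)\otimes_R M\cong Q(R)^r$). Then the $R$-module structure of $\mathrm{Hom}_R(\omega_R,M)$ extends to an $\overline R$-module structure for which $$\mathrm{Hom}_R(\omega_R,M)\cong\overline R^{\,r}$$ as $\overline R$-modules (in particular as $R$-modules). -/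

import Mathlib

open CategoryTheory TensorProduct nonZeroDivisors

universe u v

noncomputable section

/-- The integral closure of `R` in its total ring of fractions. -/
abbrev IntClosure (R : Type u) [CommRing R] : Subalgebra R (FractionRing R) :=
  integralClosure R (FractionRing R)

/-- The trace ideal of `M`: the sum of the images of all `R`-linear maps `M → R`. -/
def traceIdeal (R : Type u) [CommRing R] (M : Type v) [AddCommGroup M] [Module R M] : Ideal R :=
  ⨆ f : M →ₗ[R] R, LinearMap.range f

/-- A finitely generated module over a local ring is maximal Cohen-Macaulay if the maximal ideal
contains a regular sequence on `M` whose length is the Krull dimension of `R`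
(regularity includes `M ≠ (rs) M`, so `M` is nonzero). -/
structure IsMaximalCohenMacaulay (R : Type u) [CommRing R] [IsLocalRing R]
    (M : Type v) [AddCommGroup M] [Module R M] : Prop where
  finite : Module.Finite R M
  exists_regular : ∃ rs : List R, (∀ x ∈ rs, x ∈ IsLocalRing.maximalIdeal R) ∧
    RingTheory.Sequence.IsRegular M rs ∧ ((rs.length : ℕ∞) : WithBot ℕ∞) = ringKrullDim R

/-- A Noetherian local ring is Cohen-Macaulay if it is a maximal Cohen-Macaulay module
over itself. -/
structure IsCohenMacaulayLocal (R : Type u) [CommRing R] [IsLocalRing R] : Prop where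
  noetherian : IsNoetherianRing R
  maximal : IsMaximalCohenMacaulay R R

/-- A canonical module of a Cohen-Macaulay local ring `R` with residue field `k`: a maximal
Cohen-Macaulay module of finite injective dimension and of type one. The type of a maximal
Cohen-Macaulay module is the `k`-dimension of `Ext^d(k, ω)` with `d = dim R`; since this module is
killed by the maximal ideal, its `k`-dimension is its length over `R`. -/
structure IsCanonicalModule (R : Type u) [CommRing R] [IsLocalRing R]
    (ω : Type u) [AddCommGroup ω] [Module R ω] : Prop where
  maximal : IsMaximalCohenMacaulay R ω
  finite_injective_dimension : ∃ n : ℕ, HasInjectiveDimensionLE (ModuleCat.of R ω) n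
  type_one : ∃ d : ℕ, ringKrullDim R = ((d : ℕ∞) : WithBot ℕ∞) ∧
    Module.length R (Abelian.Ext (ModuleCat.of R (IsLocalRing.ResidueField R))
      (ModuleCat.of R ω) d) = 1

/-- `R`, with canonical module `ω`, is a far-flung Gorenstein ring. -/
structure IsFarFlungGorenstein (R : Type u) [CommRing R] [IsLocalRing R]
    (ω : Type u) [AddCommGroup ω] [Module R ω] : Prop where
  cohenMacaulay : IsCohenMacaulayLocal R
  dim_eq_one : ringKrullDim R = 1
  canonical : IsCanonicalModule R ω
  /-- There is an `R`-submodule `C ≅ ω` of the total ring of fractions lying between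
  `R` and its integral closure. -/
  exists_fractional : ∃ C : Submodule R (FractionRing R),
    1 ≤ C ∧ C ≤ Subalgebra.toSubmodule (IntClosure R) ∧ Nonempty (C ≃ₗ[R] ω)
  finite_intClosure : Module.Finite R (IntClosure R)
  /-- The trace ideal of `ω`, viewed in the total ring of fractions `Q`, is the colon ideal of all
  `α` in `Q` such that the product of `α` and the integral closure is contained in `R`. -/
  trace_eq : Submodule.map (Algebra.linearMap R (FractionRing R)) (traceIdeal R ω) =
    (1 : Submodule R (FractionRing R)) / Subalgebra.toSubmodule (IntClosure R)

/-- `M` has rank `r`: after base change to the total ring of fractions it is free of rank `r`. -/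
def HasRank (R : Type u) [CommRing R] (M : Type v) [AddCommGroup M] [Module R M] (r : ℕ) : Prop :=
  Nonempty ((FractionRing R ⊗[R] M) ≃ₗ[FractionRing R] (Fin r → FractionRing R))

end

/-! Write `Q` for the total ring of fractions and `R̄` for the integral closure. As `R̄` is finite
and local, `Q` turns out to be a field, so `R` is a domain and `R̄` is a local Dedekind domain,
hence a PID. Evaluation at `1` gives `Hom(ω, R) ≅ R : C`. This lies in the trace of `ω`, which is `R
: R̄` by hypothesis, and `R : R̄ ⊆ R : C` because `C ⊆ R̄`. So `Hom(ω, R)` is the conductor, a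
nonzero ideal of the PID `R̄`, thus isomorphic to `R̄`. Reflexivity then gives `Hom(ω, M) ≅ Hom(M*,
ω*) ≅ Hom(M*, R̄)`, finite and torsion-free over `R̄`, hence free; its rank is found by comparing
ranks over `R`. -/

/-! ### The base ring is a domain and its integral closure a PID. -/

theorem exists_mem_nonZeroDivisors_of_isCohenMacaulayLocal {R : Type u} [CommRing R]
    [IsLocalRing R] (h : IsCohenMacaulayLocal R) (hd : ringKrullDim R = 1) :
    ∃ a ∈ IsLocalRing.maximalIdeal R, a ∈ R⁰ := by
  obtain ⟨rs, hm, hreg, hlen⟩ := h.maximal.exists_regular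
  rw [hd] at hlen
  cases rs with
  | nil => simp at hlen
  | cons a l =>
    refine ⟨a, hm a (by simp), ?_⟩
    have ha := ((RingTheory.Sequence.isRegular_cons_iff R a l).1 hreg).1
    exact mem_nonZeroDivisors_iff_right.2 fun x hx => ha (by simpa [mul_comm] using hx)

/-- The total ring of fractions of a local ring of dimension at most one and positive depth has
dimension zero. -/
theorem krullDimLE_zero_fractionRing {R : Type u} [CommRing R] [IsLocalRing R]
    [Ring.KrullDimLE 1 R] {a : R} (ham : a ∈ IsLocalRing.maximalIdeal R) (ha : a ∈ R⁰) :
    Ring.KrullDimLE 0 (FractionRing R) := by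
  refine Ring.krullDimLE_zero_iff.2 fun P hP => ?_
  obtain ⟨P', hP', hle⟩ := P.exists_le_maximal hP.ne_top
  have hprime := hP'.isPrime
  -- A maximal contraction would contain `a`, which becomes a unit in `Q`.
  have hnot : ¬ (P'.comap (algebraMap R (FractionRing R))).IsMaximal := fun h => by
    have hmem : algebraMap R (FractionRing R) a ∈ P' := by
      rw [← Ideal.mem_comap, IsLocalRing.eq_maximalIdeal h]
      exact ham
    exact hprime.ne_top (P'.eq_top_of_isUnit_mem hmem
      (IsLocalization.map_units (FractionRing R) (⟨a, ha⟩ : R⁰)))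
  have hmin := (Ring.krullDimLE_one_iff.1 ‹_› _ (hprime.comap _)).resolve_right hnot
  have hcomap : P'.comap (algebraMap R (FractionRing R)) ≤ P.comap (algebraMap R _) :=
    hmin.2 ⟨hP.comap _, bot_le⟩ (Ideal.comap_mono hle)
  have : P' ≤ P := by
    rw [← IsLocalization.map_under R⁰ (FractionRing R) P',
      ← IsLocalization.map_under R⁰ (FractionRing R) P]
    exact Ideal.map_mono hcomap
  exact le_antisymm this hle ▸ hP'

/-- A local ring of positive depth whose integral closure is module-finite has a reduced total ring
of fractions. -/
theorem isReduced_fractionRing_of_finite_intClosure {R : Type u} [CommRing R] [IsLocalRing R]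
    [IsNoetherianRing R] [Module.Finite R (IntClosure R)]
    {a : R} (ham : a ∈ IsLocalRing.maximalIdeal R) (ha : a ∈ R⁰) :
    IsReduced (FractionRing R) := by
  let N : Submodule R (FractionRing R) := (nilradical (FractionRing R)).restrictScalars R
  -- Nilpotents are integral, so `N` sits in a Noetherian `R`-module and Nakayama applies once `N =
  -- aN`.
  have hN : N ≤ Subalgebra.toSubmodule (IntClosure R) := fun x hx => by
    obtain ⟨n, hn⟩ := mem_nilradical.1 hx
    refine IsIntegral.of_pow (n := n + 1) n.succ_pos ?_
    rw [pow_succ, hn, zero_mul]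
    exact isIntegral_zero
  have hfg : N.FG := by
    have : IsNoetherian R (Subalgebra.toSubmodule (IntClosure R)) :=
      isNoetherian_of_isNoetherianRing_of_finite R (IntClosure R)
    have h := IsNoetherian.noetherian (N.comap (Subalgebra.toSubmodule (IntClosure R)).subtype)
    have := h.map (Subalgebra.toSubmodule (IntClosure R)).subtype
    rwa [Submodule.map_comap_subtype, inf_eq_right.2 hN] at this
  have hsmul : N ≤ IsLocalRing.maximalIdeal R • N := fun x hx => by
    obtain ⟨b, hb⟩ := (IsLocalization.map_units (FractionRing R) (⟨a, ha⟩ : R⁰)).exists_right_inv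
    have hbx : b * x ∈ N := (nilradical (FractionRing R)).mul_mem_left b hx
    have : a • (b * x) = x := by rw [Algebra.smul_def, ← mul_assoc, hb, one_mul]
    rw [← this]
    exact Submodule.smul_mem_smul ham hbx
  have hbot := Submodule.eq_bot_of_le_smul_of_le_jacobson_bot _ N hfg hsmul
    (IsLocalRing.maximalIdeal_le_jacobson _)
  refine ⟨fun x hx => ?_⟩
  have : x ∈ N := mem_nilradical.2 hx
  rwa [hbot, Submodule.mem_bot] at this

/-- A reduced Artinian ring in which every idempotent is trivial is a field. -/
theorem isField_of_isReduced_of_idempotents_trivial {A : Type u} [CommRing A] [Nontrivial A]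
    [IsArtinianRing A] [IsReduced A] (h : ∀ e : A, IsIdempotentElem e → e = 0 ∨ e = 1) :
    IsField A := by
  refine ⟨exists_pair_ne A, mul_comm, fun {x} hx => ?_⟩
  obtain ⟨n, y, hy⟩ := IsArtinian.exists_pow_succ_smul_dvd x (1 : A)
  simp only [smul_eq_mul, mul_one, Nat.succ_eq_add_one] at hy
  -- `x ^ n * (1 - x * y) = 0` makes this element nilpotent; then `x = x ^ 2 * y`, so `x * y` is
  -- idempotent.
  have hxy : x * (1 - x * y) = 0 := by
    refine eq_zero_of_pow_eq_zero (n := n + 1) ?_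
    rw [mul_pow, pow_succ, pow_succ' (1 - x * y)]
    linear_combination (-(x * (1 - x * y) ^ n)) * hy
  rcases h (x * y) (by unfold IsIdempotentElem; linear_combination (-y) * hxy) with h0 | h1
  · exact absurd (by linear_combination hxy + x * h0) hx
  · exact ⟨y, h1⟩

/-- If the integral closure of `R` in an algebra `A` is local, the idempotents of `A` are trivial. -/
theorem idempotent_trivial_of_isLocalRing_integralClosure {R A : Type*} [CommRing R] [CommRing A]
    [Algebra R A] [IsLocalRing (integralClosure R A)] (e : A) (he : IsIdempotentElem e) :
    e = 0 ∨ e = 1 := by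
  have hint : IsIntegral R e :=
    ⟨Polynomial.X ^ 2 - Polynomial.X, by monicity!, by
      simp [pow_two, he.eq]⟩
  let e' : integralClosure R A := ⟨e, hint⟩
  have he' : e' * e' = e' := Subtype.ext he
  rcases IsLocalRing.isUnit_or_isUnit_one_sub_self e' with hu | hu
  · right
    have : e' = 1 := hu.mul_left_cancel (by rw [he', mul_one])
    exact congrArg Subtype.val this
  · left
    have : e' = 0 := hu.mul_left_cancel (by rw [sub_mul, he', one_mul, sub_self, mul_zero])
    exact congrArg Subtype.val this

theorem IsFarFlungGorenstein.isDomain {R : Type u} [CommRing R] [IsLocalRing R]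
    {ω : Type u} [AddCommGroup ω] [Module R ω] (hR : IsFarFlungGorenstein R ω)
    (hlocal : IsLocalRing (IntClosure R)) : IsDomain R := by
  have := hR.cohenMacaulay.noetherian
  have := hR.finite_intClosure
  have : Ring.KrullDimLE 1 R := Ring.krullDimLE_iff.2 (by rw [hR.dim_eq_one]; rfl)
  obtain ⟨a, ham, ha⟩ :=
    exists_mem_nonZeroDivisors_of_isCohenMacaulayLocal hR.cohenMacaulay hR.dim_eq_one
  have := krullDimLE_zero_fractionRing ham ha
  have := isReduced_fractionRing_of_finite_intClosure ham ha
  have : IsNoetherianRing (FractionRing R) := IsLocalization.isNoetherianRing R⁰ _ ‹_›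
  have : IsArtinianRing (FractionRing R) := IsNoetherianRing.isArtinianRing_of_krullDimLE_zero
  have := (isField_of_isReduced_of_idempotents_trivial (A := FractionRing R)
    (idempotent_trivial_of_isLocalRing_integralClosure (R := R))).isDomain
  exact (IsLocalization.injective (FractionRing R) le_rfl : Function.Injective
    (algebraMap R (FractionRing R))).isDomain _

/-- A module-finite local integral closure of a Noetherian domain of dimension at most one is a
principal ideal domain. -/
theorem isPrincipalIdealRing_intClosure {R : Type u} [CommRing R] [IsDomain R] [IsNoetherianRing R]
    [Ring.DimensionLEOne R] [Module.Finite R (IntClosure R)] [IsLocalRing (IntClosure R)] :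
    IsPrincipalIdealRing (IntClosure R) := by
  have : IsNoetherianRing (IntClosure R) := isNoetherian_of_tower R
    (isNoetherian_of_isNoetherianRing_of_finite R (IntClosure R))
  have : IsIntegrallyClosed (IntClosure R) :=
    integralClosure.isIntegrallyClosedOfFiniteExtension (FractionRing R)
  have : Ring.DimensionLEOne (IntClosure R) := inferInstance
  have : IsDedekindDomain (IntClosure R) := { }
  exact ((tfae_of_isNoetherianRing_of_isLocalRing_of_isDomain (IntClosure R)).out 0 2).2 this

/-! ### Ranks and duals of fractional submodules, and the conductor. -/

section FractionalSubmodule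

variable {R K : Type*} [CommRing R] [Field K] [Algebra R K] [IsFractionRing R K]

/-- The fraction field is the localization of each of its submodules containing `1`. -/
theorem isLocalizedModule_subtype_of_one_le (C : Submodule R K) (hC : 1 ≤ C) :
    IsLocalizedModule R⁰ C.subtype where
  map_units s := (Module.End.isUnit_iff _).2 <| by
    have hs : algebraMap R K s ≠ 0 := (IsLocalization.map_units K s).ne_zero
    refine ⟨fun x y hxy => ?_, fun y => ⟨(algebraMap R K s)⁻¹ * y, ?_⟩⟩
    · simpa [Algebra.smul_def, hs] using hxy
    · simp [Algebra.smul_def, hs]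
  surj y := by
    obtain ⟨⟨a, s⟩, h⟩ := IsLocalization.surj R⁰ y
    refine ⟨⟨⟨algebraMap R K a, hC (Submodule.mem_one.2 ⟨a, rfl⟩)⟩, s⟩, ?_⟩
    simpa [Submonoid.smul_def, Algebra.smul_def, mul_comm] using h
  exists_of_eq h := ⟨1, by simpa using h⟩

theorem finrank_eq_one_of_one_le (C : Submodule R K) (hC : 1 ≤ C) : Module.finrank R C = 1 := by
  have := isLocalizedModule_subtype_of_one_le C hC
  rw [← IsLocalizedModule.finrank_eq R⁰ C.subtype le_rfl, ← IsFractionRing.finrank_right_eq R K K,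
    Module.finrank_self]

theorem finrank_fin_fun_of_one_le (C : Submodule R K) (hC : 1 ≤ C) (n : ℕ) :
    Module.finrank R (Fin n → C) = n := by
  have := isLocalizedModule_subtype_of_one_le C hC
  rw [← IsLocalizedModule.finrank_eq R⁰ (.pi fun i : Fin n => C.subtype ∘ₗ .proj i) le_rfl,
    ← IsFractionRing.finrank_right_eq R K, Module.finrank_fin_fun]

/-- A linear functional on a fractional submodule containing `1` is multiplication by its value at
`1`. -/
theorem algebraMap_apply_eq_mul_apply_one (C : Submodule R K) (h1 : (1 : K) ∈ C) (f : C →ₗ[R] R)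
    (x : C) : algebraMap R K (f x) = x * algebraMap R K (f ⟨1, h1⟩) := by
  obtain ⟨⟨a, s⟩, h⟩ := IsLocalization.surj R⁰ (x : K)
  have hs : algebraMap R K s ≠ 0 := (IsLocalization.map_units K s).ne_zero
  have hx : (s : R) • x = a • (⟨1, h1⟩ : C) := Subtype.ext <| by
    simpa [Algebra.smul_def, mul_comm] using h
  have hf := congrArg (fun y => algebraMap R K (f y)) hx
  simp only [map_smul, smul_eq_mul, map_mul] at hf
  refine mul_left_cancel₀ hs ?_
  rw [hf, ← mul_assoc, mul_comm (algebraMap R K s), h]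

/-- Evaluation at `1`, as a map from the dual of a fractional submodule containing `1` to the
fraction field. -/
def dualEvalOne (C : Submodule R K) (h1 : (1 : K) ∈ C) : Module.Dual R C →ₗ[R] K :=
  Algebra.linearMap R K ∘ₗ Module.Dual.eval R C ⟨1, h1⟩

theorem dualEvalOne_injective [IsDomain R] (C : Submodule R K) (h1 : (1 : K) ∈ C) :
    Function.Injective (dualEvalOne C h1) := fun f g h => LinearMap.ext fun x => by
  refine IsFractionRing.injective R K ?_
  exact (algebraMap_apply_eq_mul_apply_one C h1 f x).trans <|
    (congrArg (fun y : K => (x : K) * y) h).trans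
      (algebraMap_apply_eq_mul_apply_one C h1 g x).symm

theorem range_dualEvalOne [IsDomain R] (C : Submodule R K) (h1 : (1 : K) ∈ C) :
    LinearMap.range (dualEvalOne C h1) = 1 / C := by
  ext α
  rw [Submodule.mem_div_iff_forall_mul_mem]
  constructor
  · rintro ⟨f, rfl⟩ y hy
    rw [mul_comm]
    exact Submodule.mem_one.2 ⟨f ⟨y, hy⟩, algebraMap_apply_eq_mul_apply_one C h1 f ⟨y, hy⟩⟩
  · intro h
    let e := LinearEquiv.ofInjective (Algebra.linearMap R K) (IsFractionRing.injective R K)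
    let m : C →ₗ[R] LinearMap.range (Algebra.linearMap R K) :=
      (LinearMap.mulLeft R α ∘ₗ C.subtype).codRestrict _ fun y => by
        simpa using Submodule.mem_one.1 (h y y.2)
    refine ⟨e.symm.toLinearMap ∘ₗ m, ?_⟩
    have : ((e (e.symm (m ⟨1, h1⟩)) : LinearMap.range (Algebra.linearMap R K)) : K) = α := by
      rw [e.apply_symm_apply]
      exact mul_one α
    exact this

/-- The conductor of a module-finite overring of `R` which is a principal ideal domain is
isomorphic to that overring. -/
theorem nonempty_equiv_conductor [IsDomain R] (V : Subalgebra R K) [IsPrincipalIdealRing V]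
    [Module.Finite R V] :
    Nonempty (V ≃ₗ[R] ↥((1 : Submodule R K) / Subalgebra.toSubmodule V)) := by
  let A := (1 : Submodule R K) / Subalgebra.toSubmodule V
  have hA {x : K} : x ∈ A ↔ ∀ y ∈ V, x * y ∈ (1 : Submodule R K) :=
    Submodule.mem_div_iff_forall_mul_mem
  have hAV {x : K} (hx : x ∈ A) : x ∈ V := by
    obtain ⟨a, ha⟩ := Submodule.mem_one.1 (hA.1 hx 1 V.one_mem)
    rw [mul_one] at ha
    exact ha ▸ V.algebraMap_mem a
  -- The conductor is also an ideal of `V`, hence principal.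
  let I : Ideal V :=
    { carrier := {b | (b : K) ∈ A}
      add_mem' := fun ha hb => A.add_mem ha hb
      zero_mem' := A.zero_mem
      smul_mem' := fun c b hb => hA.2 fun y hy => by
        have := hA.1 hb (c * y) (V.mul_mem c.2 hy)
        rwa [← mul_assoc, mul_comm (b : K)] at this }
  obtain ⟨g, hg⟩ := (IsPrincipalIdealRing.principal I).principal
  -- A common denominator of the finite module `V` is a nonzero element of the conductor.
  have hg0 : (g : K) ≠ 0 := fun h0 => by
    have hfg : (Subalgebra.toSubmodule V).FG :=
      Module.Finite.iff_fg.1 (inferInstanceAs (Module.Finite R V))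
    obtain ⟨d, hd, hdV⟩ := FractionalIdeal.isFractional_of_fg (S := R⁰) hfg
    have hdI : algebraMap R V d ∈ I := hA.2 fun y hy => by
      obtain ⟨a, ha⟩ := hdV y hy
      exact Submodule.mem_one.2 ⟨a, by rw [ha, Algebra.smul_def]; rfl⟩
    rw [hg, show g = 0 from Subtype.ext h0, Submodule.span_zero_singleton, Submodule.mem_bot] at hdI
    exact (IsLocalization.map_units K (⟨d, hd⟩ : R⁰)).ne_zero (congrArg Subtype.val hdI)
  let ψ : V →ₗ[R] K := LinearMap.mulRight R (g : K) ∘ₗ V.val.toLinearMap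
  have hψ : Function.Injective ψ := fun a b h => Subtype.ext (mul_right_cancel₀ hg0 h)
  have hrange : LinearMap.range ψ = A := by
    ext x
    constructor
    · rintro ⟨b, rfl⟩
      have : b * g ∈ I := I.mul_mem_left b (hg ▸ Submodule.mem_span_singleton_self g)
      exact this
    · intro hx
      have : (⟨x, hAV hx⟩ : V) ∈ I := hx
      rw [hg] at this
      obtain ⟨b, hb⟩ := Submodule.mem_span_singleton.1 this
      exact ⟨b, congrArg Subtype.val hb⟩
  exact ⟨LinearEquiv.ofInjective ψ hψ ≪≫ₗ LinearEquiv.ofEq _ _ hrange⟩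

end FractionalSubmodule

/-! ### The far-flung condition, rank counts and the conclusion. -/

/-- If `R` is far-flung Gorenstein, then `R : C = R : R̄` for a fractional canonical module `C`
between `R` and its integral closure. -/
theorem IsFarFlungGorenstein.one_div_eq {R : Type u} [CommRing R] [IsLocalRing R] [IsDomain R]
    {ω : Type u} [AddCommGroup ω] [Module R ω] (hR : IsFarFlungGorenstein R ω)
    {C : Submodule R (FractionRing R)} (h1 : 1 ≤ C)
    (hC : C ≤ Subalgebra.toSubmodule (IntClosure R)) (e : C ≃ₗ[R] ω) :
    1 / C = (1 : Submodule R (FractionRing R)) / Subalgebra.toSubmodule (IntClosure R) := by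
  have h1C : (1 : FractionRing R) ∈ C := h1 (Submodule.mem_one.2 ⟨1, map_one _⟩)
  apply le_antisymm
  · rw [← range_dualEvalOne C h1C, ← hR.trace_eq]
    rintro _ ⟨f, rfl⟩
    refine ⟨f ⟨1, h1C⟩, ?_, rfl⟩
    exact (le_iSup (fun f : ω →ₗ[R] R => LinearMap.range f) (f ∘ₗ e.symm.toLinearMap))
      ⟨e ⟨1, h1C⟩, by simp⟩
  · intro x hx
    rw [Submodule.mem_div_iff_forall_mul_mem] at hx ⊢
    exact fun y hy => hx y (hC hy)

/-- The rank of a Hom module is the product of the ranks. -/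
theorem finrank_linearMap_of_finitePresentation {R : Type*} [CommRing R] [IsDomain R]
    (N : Type*) (M : Type*) [AddCommGroup N] [AddCommGroup M] [Module R N] [Module R M]
    [Module.FinitePresentation R N] :
    Module.finrank R (N →ₗ[R] M) = Module.finrank R N * Module.finrank R M := by
  let K := FractionRing R
  let f := TensorProduct.mk R K N 1
  let g := TensorProduct.mk R K M 1
  -- Finite presentation of `N` lets Hom commute with localization, reducing to dimensions over `K`.
  rw [← IsLocalizedModule.finrank_eq (N := K ⊗[R] N →ₗ[K] K ⊗[R] M) R⁰
      (IsLocalizedModule.mapExtendScalars R⁰ f g K) le_rfl,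
    ← IsLocalizedModule.finrank_eq R⁰ f le_rfl, ← IsLocalizedModule.finrank_eq R⁰ g le_rfl,
    ← IsFractionRing.finrank_right_eq R K, ← IsFractionRing.finrank_right_eq R K,
    ← IsFractionRing.finrank_right_eq R K (K ⊗[R] N →ₗ[K] K ⊗[R] M), Module.finrank_linearMap]

theorem HasRank.finrank_eq {R : Type u} [CommRing R] [IsDomain R] {M : Type v} [AddCommGroup M]
    [Module R M] {r : ℕ} (h : HasRank R M r) : Module.finrank R M = r := by
  obtain ⟨e⟩ := h
  rw [← IsLocalizedModule.finrank_eq R⁰ (TensorProduct.mk R (FractionRing R) M 1) le_rfl,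
    ← IsFractionRing.finrank_right_eq R (FractionRing R), e.finrank_eq, Module.finrank_fin_fun]

theorem mainTheorem4 (R : Type u) [CommRing R] [IsLocalRing R]
    (ω : Type u) [AddCommGroup ω] [Module R ω]
    (hR : IsFarFlungGorenstein R ω)
    (hlocal : IsLocalRing (IntClosure R))
    (M : Type v) [AddCommGroup M] [Module R M] [Module.Finite R M]
    (hM : Module.IsReflexive R M)
    (r : ℕ) (hr : 0 < r) (hrank : HasRank R M r) :
    ∃ _ : Module (IntClosure R) (ω →ₗ[R] M),
      IsScalarTower R (IntClosure R) (ω →ₗ[R] M) ∧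
      Nonempty ((ω →ₗ[R] M) ≃ₗ[IntClosure R] (Fin r → IntClosure R)) := by
  have := hR.isDomain hlocal
  have := hR.cohenMacaulay.noetherian
  have := hR.finite_intClosure
  have := hR.canonical.maximal.finite
  have : Module.FinitePresentation R ω := Module.finitePresentation_of_finite R ω
  have : Ring.KrullDimLE 1 R := Ring.krullDimLE_iff.2 (by rw [hR.dim_eq_one]; rfl)
  have : Ring.DimensionLEOne R := ⟨fun {p} hp hprime =>
    (Ring.krullDimLE_one_iff.1 ‹_› p hprime).resolve_left fun h =>
      hp (by simpa [IsDomain.minimalPrimes_eq_singleton_bot] using h)⟩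
  have : IsPrincipalIdealRing (IntClosure R) := isPrincipalIdealRing_intClosure
  obtain ⟨C, h1, hC, ⟨e⟩⟩ := hR.exists_fractional
  have h1C : (1 : FractionRing R) ∈ C := h1 (Submodule.mem_one.2 ⟨1, map_one _⟩)
  obtain ⟨φ⟩ := nonempty_equiv_conductor (IntClosure R)
  -- `Hom(ω, R) ≅ R : C = R : R̄ ≅ R̄`
  let δ : Module.Dual R ω ≃ₗ[R] IntClosure R := e.dualMap ≪≫ₗ
    LinearEquiv.ofInjective _ (dualEvalOne_injective C h1C) ≪≫ₗ
    LinearEquiv.ofEq _ _ ((range_dualEvalOne C h1C).trans (hR.one_div_eq h1 hC e)) ≪≫ₗ φ.symm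
  -- `Hom(ω, M) ≅ Hom(ω, M**) ≅ Hom(M*, ω*) ≅ Hom(M*, R̄)`
  let η : (ω →ₗ[R] M) ≃ₗ[R] (Module.Dual R M →ₗ[R] IntClosure R) :=
    (Module.evalEquiv R M).congrRight ≪≫ₗ LinearMap.lflip ≪≫ₗ δ.congrRight
  have : Module.Finite R (Module.Dual R M →ₗ[R] IntClosure R) := inferInstance
  have : Module.Finite (IntClosure R) (Module.Dual R M →ₗ[R] IntClosure R) :=
    .of_restrictScalars_finite R _ _
  have : Module.Free (IntClosure R) (Module.Dual R M →ₗ[R] IntClosure R) :=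
    Module.free_of_finite_type_torsion_free' (R := IntClosure R)
      (M := Module.Dual R M →ₗ[R] IntClosure R)
  let b := Module.finBasis (IntClosure R) (Module.Dual R M →ₗ[R] IntClosure R)
  -- Over `R`, `R̄ ^ n` has rank `n`, while `Hom(ω, M)` has rank `1 * r`.
  have hn : Module.finrank (IntClosure R) (Module.Dual R M →ₗ[R] IntClosure R) = r := by
    have h := (η ≪≫ₗ b.equivFun.restrictScalars R).finrank_eq
    have h2 := finrank_fin_fun_of_one_le (Subalgebra.toSubmodule (IntClosure R)) (h1.trans hC)
      (Module.finrank (IntClosure R) (Module.Dual R M →ₗ[R] IntClosure R))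
    rw [finrank_linearMap_of_finitePresentation, ← e.finrank_eq, finrank_eq_one_of_one_le C h1,
      hrank.finrank_eq, one_mul] at h
    exact h2.symm.trans h.symm
  let ε := b.equivFun ≪≫ₗ LinearEquiv.funCongrLeft _ _ (finCongr hn.symm)
  -- The action is transported along `η`; it extends that of `R` because `η` is `R`-linear.
  let : Module (IntClosure R) (ω →ₗ[R] M) := η.toAddEquiv.module (IntClosure R)
  refine ⟨inferInstance, η.isScalarTower (IntClosure R), ⟨?_⟩⟩
  exact { η.toAddEquiv with map_smul' := fun a x => η.apply_symm_apply _ } ≪≫ₗ ε
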